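/- Let $d\ge 3$, $c_->0$ and $b\in\mathbb R$. Then there exist constants $C_1,C_2>0$, depending only on $d$, $c_-$ and $b$, such that the following holds. Let $V:\mathbb R\to\mathbb R$ be twice differentiable with $\inf_t V''(t)=c_-$ and $V'(0)=b$ (so $b=0$ if $V$ is even). For $\varepsilon>1$, a finite non-empty $\Lambda\subset\mathbb Z^d$ and $\eta\in\mathbb R^{\mathbb Z^d}$, let $\mu_{\varepsilon,\Lambda}[\eta]$ be the Gibbs measure on $\mathbb R^\Lambda$ $$\mu_{\varepsilon,\Lambda}[\eta](d\varphi)=\frac{1}{Z_{\varepsilon,\Lambda}[\eta]}\exp\Bigl(-\frac1{4d}\sum_{\langle i,j\rangle\subset\Lambda}V(\varphi_i-\varphi_j)-\frac1{4d}\sum_{i\in\Lambda,\,j\in\Lambda^c,\,|i-j|=1}V(\varphi_i)+\sum_{i\in\Lambda}\eta_i\varphi_i\Bigr)\prod_{i\in\Lambda}\bigl(d\varphi_i+\varepsilon\,\delta_0(d\varphi_i)\bigr),$$ where the first sum runs over the unordered nearest-neighbour pairs in $\Lambda$ (for a $V$ that is not even, $V(\varphi_i-\varphi_j)$ is read there as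 $\frac12[V(\varphi_i-\varphi_j)+V(\varphi_j-\varphi_i)]$) and $Z_{\varepsilon,\Lambda}[\eta]$ is the normalization constant; for every $\eta$ this is a well-defined probability measure. Let $(\eta_i)_{i\in\mathbb Z^d}$ be i.i.d. real random variables whose common distribution is symmetric with finite second moment. Then for all $\varepsilon>1$ and all finite non-empty $\Lambda\subset\mathbb Z^d$, $$\frac1{|\Lambda|}\sum_{i\in\Lambda}\mathbb E\bigl(\mu_{\varepsilon,\Lambda}[\eta](\varphi_i=0)\bigr)\;\ge\;1-\frac{C_1+C_2\,\mathbb E(\eta_0^2)}{\log\varepsilon}.$$ -/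

import Mathlib

open MeasureTheory ProbabilityTheory

noncomputable section

namespace PinnedInterface

/-- The nearest neighbours of a site `i` of `ℤ^d`: the sites at Euclidean
(equivalently, `ℓ¹`) distance one; see `mem_neighbors`. -/
def neighbors {d : ℕ} (i : Fin d → ℤ) : Finset (Fin d → ℤ) :=
  (Finset.Icc (i - 1) (i + 1)).filter fun j => ∑ k, |i k - j k| = 1

theorem mem_neighbors {d : ℕ} (i j : Fin d → ℤ) :
    j ∈ neighbors i ↔ ∑ k, |i k - j k| = 1 := by
  unfold neighbors
  rw [Finset.mem_filter, and_iff_right_iff_imp]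
  intro h
  have key : ∀ k, |i k - j k| ≤ 1 := fun k => by
    rw [← h]
    exact Finset.single_le_sum (f := fun k => |i k - j k|) (fun _ _ => abs_nonneg _)
      (Finset.mem_univ k)
  rw [Finset.mem_Icc]
  constructor <;> intro k <;> have := abs_le.1 (key k) <;> simp <;> omega

/-- The Hamiltonian in the volume `Λ` with boundary condition zero and external field `h`.
The sum over the bonds `⟨i,j⟩` inside `Λ` is written as half of the sum over ordered pairs, so that
for an even `V` each unordered bond contributes `V (φ i - φ j)` once. -/
def energy {d : ℕ} (V : ℝ → ℝ) (Λ : Finset (Fin d → ℤ)) (h : (Fin d → ℤ) → ℝ)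
    (φ : Λ → ℝ) : ℝ :=
  1 / (4 * (d : ℝ)) *
      ((1 / 2) * ∑ i : Λ,
        ∑ j ∈ Finset.univ.filter (fun j : Λ => (j : Fin d → ℤ) ∈ neighbors (i : Fin d → ℤ)),
          V (φ i - φ j))
    + 1 / (4 * (d : ℝ)) * ∑ i : Λ, ∑ _j ∈ neighbors (i : Fin d → ℤ) \ Λ, V (φ i)
    - ∑ i : Λ, h i * φ i

/-- The a priori measure `∏_{i ∈ Λ} (dφ_i + ε δ_0(dφ_i))`. -/
def referenceMeasure {d : ℕ} (ε : ℝ) (Λ : Finset (Fin d → ℤ)) : Measure (Λ → ℝ) :=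
  Measure.pi fun _ => (volume : Measure ℝ) + ε.toNNReal • Measure.dirac 0

/-- The unnormalized Gibbs measure `exp(-H) ∏ (dφ_i + ε δ_0(dφ_i))`. -/
def gibbsWeight {d : ℕ} (V : ℝ → ℝ) (ε : ℝ) (Λ : Finset (Fin d → ℤ))
    (h : (Fin d → ℤ) → ℝ) : Measure (Λ → ℝ) :=
  (referenceMeasure ε Λ).withDensity fun φ => ENNReal.ofReal (Real.exp (-energy V Λ h φ))

/-- The partition function. -/
def partitionFunction {d : ℕ} (V : ℝ → ℝ) (ε : ℝ) (Λ : Finset (Fin d → ℤ))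
    (h : (Fin d → ℤ) → ℝ) : ENNReal :=
  gibbsWeight V ε Λ h Set.univ

/-- The finite-volume Gibbs measure for the fixed field configuration `h`. -/
def gibbs {d : ℕ} (V : ℝ → ℝ) (ε : ℝ) (Λ : Finset (Fin d → ℤ))
    (h : (Fin d → ℤ) → ℝ) : Measure (Λ → ℝ) :=
  (partitionFunction V ε Λ h)⁻¹ • gibbsWeight V ε Λ h

/-- The Gibbs probability that the site `i` of `Λ` is pinned. -/
def pinProb {d : ℕ} (V : ℝ → ℝ) (ε : ℝ) (Λ : Finset (Fin d → ℤ))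
    (h : (Fin d → ℤ) → ℝ) (i : Λ) : ℝ :=
  (gibbs V ε Λ h).real {φ | φ i = 0}

end PinnedInterface

end

noncomputable section

namespace PinnedInterface

/-! Let N be the number of pinned sites. By Jensen, exp(-log ε · E N) is at most the Gibbs mean of
ε^{-N}, a quotient of integrals. The denominator Z is at least ε^{|Λ|} e^{-H(0)}, from the single
configuration 0 (`partitionFunction_ge`). In the numerator the weight ε^{-N} turns the a priori
measure into dφ + δ_0, and a bound e^{R-H(0)} B^{|Λ|} uniform in ε follows once H(φ) - H(0) + R
dominates a sum of squared increments in one lattice direction. Taking logarithms gives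
`le_sum_pinProb`.

The energy bound must absorb the linear field term. In dimension at least three there is a unit flow
from a site to infinity with square-summable values: the urn flow. Superposing its translates with
strengths h_i writes the field as the divergence of a flow, so summation by parts turns ∑ h_i φ_i
into a pairing of that flow with the gradient of φ, and Young's inequality charges it to half of the
Dirichlet form plus a multiple of the flow energy (`sum_field_le`). For independent centred fields
the cross terms vanish in the mean, so the expected flow energy is at most a constant times |Λ|
E(η_0²) (`integral_flowEnergy_le`). -/

/-! ### Growth of the potential and iterated integration -/

/-- A potential with curvature at least `c` grows quadratically. -/
theorem quadratic_lower_bound {V : ℝ → ℝ} {b c : ℝ} (hc : 0 < c) (hV : Differentiable ℝ V)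
    (hV' : Differentiable ℝ (deriv V)) (hV'' : ∀ t, c ≤ deriv (deriv V) t) (hb : deriv V 0 = b)
    (t : ℝ) : V 0 + c / 4 * t ^ 2 - b ^ 2 / c ≤ V t := by
  -- Minus this parabola, the potential is still convex and has a critical point at 0, hence its
  -- minimum there.
  set g : ℝ → ℝ := fun t => V t - (b * t + c / 2 * t ^ 2) with hg
  have hg' : deriv g = fun t => deriv V t - (b + c * t) := by
    funext t
    have h1 : HasDerivAt (fun t : ℝ => b * t + c / 2 * t ^ 2) (b + c * t) t := by
      refine (((hasDerivAt_id' t).const_mul b).fun_add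
        (((hasDerivAt_id' t).fun_pow 2).const_mul (c / 2))).congr_deriv ?_
      norm_num
      ring
    exact ((hV t).hasDerivAt.sub h1).deriv
  have hgd : Differentiable ℝ g := by
    rw [hg]
    fun_prop
  have hmono : Monotone (deriv g) := by
    rw [hg']
    refine monotone_of_deriv_nonneg (by fun_prop) fun t => ?_
    have h1 : HasDerivAt (fun t : ℝ => b + c * t) c t := by
      simpa using ((hasDerivAt_id t).const_mul c).const_add b
    rw [((hV' t).hasDerivAt.fun_sub h1).deriv]
    linarith [hV'' t]
  have hmin : g 0 ≤ g t := by
    have hconv := hmono.convexOn_univ_of_deriv hgd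
    have h0 : deriv g 0 = 0 := by simp [hg', hb]
    rcases lt_trichotomy t 0 with ht | rfl | ht
    · have := hconv.slope_le_deriv (Set.mem_univ t) (Set.mem_univ 0) ht (hgd 0)
      rw [h0, slope_def_field, div_le_iff₀ (by linarith)] at this
      linarith
    · rfl
    · have := hconv.deriv_le_slope (Set.mem_univ 0) (Set.mem_univ t) ht (hgd 0)
      rw [h0, slope_def_field, le_div_iff₀ (by linarith)] at this
      linarith
  simp only [hg] at hmin
  -- Completing the square spends half of the quadratic term on the linear term `b * t`.
  have h2 : 0 ≤ (c / 2 * t + b) ^ 2 / c := by positivity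
  have h3 : (c / 2 * t + b) ^ 2 / c = c / 4 * t ^ 2 + b * t + b ^ 2 / c := by
    field_simp
    ring
  linarith

/-- Successive integration of a product of kernels along a triangular dependence structure. -/
theorem lintegral_pi_prod_le {ι : Type*} [Fintype ι] [DecidableEq ι] (ν : Measure ℝ) [SigmaFinite ν]
    (r : ι → ℤ) (w : ι → (ι → ℝ) → ℝ) (hw : ∀ i, Measurable (w i))
    (hwr : ∀ i j, r j ≤ r i → ∀ x y, w i (Function.update x j y) = w i x)
    (κ : ℝ → ℝ → ENNReal) (hκ : Measurable (Function.uncurry κ)) (K : ENNReal)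
    (hK : ∀ x, ∫⁻ t, κ t x ∂ν ≤ K) :
    ∫⁻ φ, ∏ i, κ (φ i) (w i φ) ∂(Measure.pi fun _ : ι => ν) ≤ K ^ Fintype.card ι := by
  have hmeas : ∀ i, Measurable fun φ : ι → ℝ => κ (φ i) (w i φ) := fun i =>
    hκ.comp ((measurable_pi_apply i).prodMk (hw i))
  have hprod : ∀ s : Finset ι, Measurable fun φ : ι → ℝ => ∏ i ∈ s, κ (φ i) (w i φ) := fun s =>
    Finset.measurable_fun_prod s fun i _ => hmeas i
  have key : ∀ s : Finset ι, ∀ x,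
      (∫⋯∫⁻_s, (fun φ => ∏ i ∈ s, κ (φ i) (w i φ)) ∂(fun _ : ι => ν)) x ≤ K ^ s.card := by
    intro s
    induction s using Finset.induction_on_min_value r with
    | empty => intro x; simp
    | insert a s ha hmin ih =>
      intro x
      rw [lmarginal_insert' _ (hprod _) ha]
      have hle : (fun x : ι → ℝ => ∫⁻ t, (fun φ : ι → ℝ => ∏ i ∈ insert a s, κ (φ i) (w i φ))
          (Function.update x a t) ∂ν) ≤ fun x => K * ∏ i ∈ s, κ (x i) (w i x) := by
        intro x
        -- Since `a` has least rank, neither its own centre nor any other depends on coordinate `a`: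
        -- the innermost integral meets a single factor.
        have hfac : ∀ t, ∏ i ∈ insert a s, κ (Function.update x a t i) (w i (Function.update x a t))
            = (∏ i ∈ s, κ (x i) (w i x)) * κ t (w a x) := by
          intro t
          rw [Finset.prod_insert ha, mul_comm, Function.update_self, hwr a a le_rfl]
          congr 1
          refine Finset.prod_congr rfl fun i hi => ?_
          rw [hwr i a (hmin i hi), Function.update_of_ne (ne_of_mem_of_not_mem hi ha)]
        simp only [hfac]
        have hκa : Measurable fun t => κ t (w a x) :=
          hκ.comp (measurable_id.prodMk measurable_const)
        rw [lintegral_const_mul _ hκa, mul_comm]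
        gcongr
        exact hK _
      refine (lmarginal_mono hle x).trans ?_
      have : (∫⋯∫⁻_s, (fun x => K * ∏ i ∈ s, κ (x i) (w i x)) ∂(fun _ : ι => ν)) x
          = K * (∫⋯∫⁻_s, (fun φ => ∏ i ∈ s, κ (φ i) (w i φ)) ∂(fun _ : ι => ν)) x := by
        simp only [lmarginal]
        rw [lintegral_const_mul]
        exact (hprod s).comp measurable_updateFinset
      rw [this, Finset.card_insert_of_notMem ha, pow_succ']
      gcongr
      exact ih x
  rw [lintegral_eq_lmarginal_univ (fun _ => 0)]
  exact key Finset.univ _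

/-! ### A finite-energy flow to infinity -/

section Flow

variable {d : ℕ} (hd : 3 ≤ d)

/-- The first three unit vectors of `ℤ^d`. -/
def unitVec (k : Fin 3) : Fin d → ℤ := Pi.single (Fin.castLE hd k) 1

/-- The non-negative orthant of the sublattice `ℤ^3 × {0}` of `ℤ^d`. -/
def InOrthant (x : Fin d → ℤ) : Prop := (∀ j, 0 ≤ x j) ∧ ∀ j : Fin d, 3 ≤ j.val → x j = 0

/-- The sum of the first three coordinates. -/
def level (x : Fin d → ℤ) : ℤ := ∑ k, x (Fin.castLE hd k)

open Classical in
/-- The flow from the origin to infinity of Pólya's urn with three colours: the flow across the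
bond `{x, x + e_k}`, which spreads uniformly over each level of the orthant. -/
def urnFlow (k : Fin 3) (x : Fin d → ℤ) : ℝ :=
  if InOrthant x then
    2 * (x (Fin.castLE hd k) + 1) / ((level hd x + 1) * (level hd x + 2) * (level hd x + 3))
  else 0

theorem castLE_eq_of_lt (j : Fin d) (hj : j.val < 3) : Fin.castLE hd ⟨j.val, hj⟩ = j := rfl

/-- The orthant formula survives at the faces: if the `k`-th coordinate is 0, the shifted site
leaves the orthant and the numerator vanishes as well. -/
theorem urnFlow_sub_unitVec (k : Fin 3) {x : Fin d → ℤ} (hx : InOrthant x) :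
    urnFlow hd k (x - unitVec hd k) =
      2 * x (Fin.castLE hd k) / (level hd x * (level hd x + 1) * (level hd x + 2)) := by
  have hlev : level hd (x - unitVec hd k) = level hd x - 1 := by
    have : ∑ i : Fin 3, (Pi.single (Fin.castLE hd k) (1 : ℤ) : Fin d → ℤ) (Fin.castLE hd i) = 1 := by
      rw [Finset.sum_eq_single k] <;> simp +contextual
    simp only [level, unitVec, Pi.sub_apply, Finset.sum_sub_distrib, this]
  rcases (hx.1 (Fin.castLE hd k)).eq_or_lt with h0 | h0
  · have : ¬ InOrthant (x - unitVec hd k) := fun h => by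
      have := h.1 (Fin.castLE hd k)
      simp [unitVec] at this
      omega
    rw [urnFlow, if_neg this, ← h0]
    simp
  · have : InOrthant (x - unitVec hd k) := by
      refine ⟨fun j => ?_, fun j hj => ?_⟩
      · by_cases hjk : j = Fin.castLE hd k
        · subst hjk
          simp [unitVec]
          omega
        · simpa [unitVec, hjk] using hx.1 j
      · have hjk : j ≠ Fin.castLE hd k := by
          rintro rfl
          simp at hj
          omega
        simpa [unitVec, hjk] using hx.2 j hj
    rw [urnFlow, if_pos this, hlev]
    simp only [unitVec, Pi.sub_apply, Pi.single_eq_same]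
    push_cast
    congr 1 <;> ring

/-- The urn flow has a unit source at the origin and no other source or sink. -/
theorem urnFlow_divergence (x : Fin d → ℤ) :
    ∑ k, (urnFlow hd k x - urnFlow hd k (x - unitVec hd k)) = if x = 0 then 1 else 0 := by
  by_cases hx : InOrthant x
  · have hlev : (∑ k : Fin 3, (x (Fin.castLE hd k) : ℝ)) = level hd x := by
      simp [level]
    have hl0 : 0 ≤ level hd x := Finset.sum_nonneg fun k _ => hx.1 _
    have hl0' : (0 : ℝ) ≤ level hd x := by exact_mod_cast hl0
    rw [Finset.sum_sub_distrib]
    simp only [urnFlow_sub_unitVec hd _ hx]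
    simp only [urnFlow, if_pos hx]
    rw [← Finset.sum_div, ← Finset.sum_div, ← Finset.mul_sum, ← Finset.mul_sum,
      Finset.sum_add_distrib, hlev]
    simp only [Finset.sum_const, Finset.card_univ, Fintype.card_fin, nsmul_eq_mul, mul_one,
      Nat.cast_ofNat]
    -- With L the level, outflow 2(L+3)/((L+1)(L+2)(L+3)) and inflow 2L/(L(L+1)(L+2)) agree for L ≠
    -- 0. At the origin the outflow is 1 and the inflow is 0/0, read as 0.
    by_cases h0 : x = 0
    · have : level hd x = 0 := by simp [level, h0]
      rw [this, if_pos h0]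
      norm_num
    · have hne : level hd x ≠ 0 := by
        intro h
        apply h0
        have hz := (Finset.sum_eq_zero_iff_of_nonneg fun k _ => hx.1 _).1 h
        funext j
        by_cases hj : j.val < 3
        · have := hz ⟨j.val, hj⟩ (Finset.mem_univ _)
          rwa [castLE_eq_of_lt] at this
        · exact hx.2 j (by omega)
      have hne' : (level hd x : ℝ) ≠ 0 := by exact_mod_cast hne
      rw [if_neg h0]
      field_simp
      ring
  · have hx' : ∀ k, ¬ InOrthant (x - unitVec hd k) := by
      intro k h
      apply hx
      refine ⟨fun j => ?_, fun j hj => ?_⟩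
      · have := h.1 j
        by_cases hjk : j = Fin.castLE hd k
        · subst hjk
          simp [unitVec] at this
          omega
        · simpa [unitVec, hjk] using this
      · have hjk : j ≠ Fin.castLE hd k := by
          rintro rfl
          simp at hj
          omega
        simpa [unitVec, hjk] using h.2 j hj
    have h0 : x ≠ 0 := by
      rintro rfl
      exact hx ⟨fun _ => le_rfl, fun _ _ => rfl⟩
    simp [urnFlow, hx, hx', h0]

/-- The flow is at most 2/(L+1)² at level L. Its square decays with exponent 4, which is shared
equally by three coordinates; 4/3 > 1 makes each factor summable. -/
theorem urnFlow_sq_le (k : Fin 3) {x : Fin d → ℤ} (hx : InOrthant x) :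
    urnFlow hd k x ^ 2 ≤
      4 * ∏ i : Fin 3, 1 / |((x (Fin.castLE hd i)).toNat : ℝ) + 1| ^ (4 / 3 : ℝ) := by
  have hnn : ∀ i, (0 : ℝ) ≤ x (Fin.castLE hd i) := fun i => by exact_mod_cast hx.1 _
  have hle : ∀ i, (x (Fin.castLE hd i) : ℝ) ≤ level hd x := fun i => by
    exact_mod_cast Finset.single_le_sum (f := fun k => x (Fin.castLE hd k)) (fun k _ => hx.1 _)
      (Finset.mem_univ i)
  have hl0 : (0 : ℝ) ≤ level hd x := (hnn 0).trans (hle 0)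
  set S : ℝ := ((level hd x : ℤ) : ℝ) with hS
  have hcast : ∀ i, ((x (Fin.castLE hd i)).toNat : ℝ) = x (Fin.castLE hd i) := fun i => by
    exact_mod_cast Int.toNat_of_nonneg (hx.1 _)
  have h1 : urnFlow hd k x ≤ 2 / (S + 1) ^ 2 := by
    rw [urnFlow, if_pos hx, div_le_div_iff₀ (by positivity) (by positivity)]
    have := hle k
    have h2 : (x (Fin.castLE hd k) + 1 : ℝ) ≤ S + 1 := by linarith
    calc 2 * (x (Fin.castLE hd k) + 1 : ℝ) * (S + 1) ^ 2 ≤ 2 * (S + 1) * (S + 1) ^ 2 := by gcongr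
      _ ≤ 2 * ((S + 1) * (S + 2) * (S + 3)) := by nlinarith
  have h0 : 0 ≤ urnFlow hd k x := by
    rw [urnFlow, if_pos hx]
    have := hnn k
    positivity
  calc urnFlow hd k x ^ 2 ≤ (2 / (S + 1) ^ 2) ^ 2 := by gcongr
    _ = 4 * ∏ i : Fin 3, 1 / (S + 1) ^ (4 / 3 : ℝ) := by
      have : ((S + 1) ^ (4 / 3 : ℝ)) ^ 3 = (S + 1) ^ 4 := by
        rw [← Real.rpow_natCast, ← Real.rpow_mul (by positivity), ← Real.rpow_natCast]
        norm_num
      rw [Finset.prod_const, Finset.card_univ, Fintype.card_fin, div_pow, div_pow, this, one_pow]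
      ring
    _ ≤ _ := by
      gcongr with i
      rw [hcast, abs_of_nonneg (by linarith [hnn i])]
      linarith [hle i]

/-- The urn flow has finite energy. -/
theorem urnFlow_energy_bounded :
    ∃ C : ℝ, 0 < C ∧ ∀ (k : Fin 3) (Y : Finset (Fin d → ℤ)), ∑ y ∈ Y, urnFlow hd k y ^ 2 ≤ C := by
  classical
  set p : ℕ → ℝ := fun n => 1 / |(n : ℝ) + 1| ^ (4 / 3 : ℝ) with hp
  have hp0 : 0 ≤ p := fun n => by simp only [hp, Pi.zero_apply]; positivity
  have hps : Summable p := (Real.summable_one_div_nat_add_rpow 1 (4 / 3)).2 (by norm_num)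
  have hps2 : Summable fun q : ℕ × ℕ => p q.1 * p q.2 := hps.mul_of_nonneg hps hp0 hp0
  have hps3 : Summable fun q : ℕ × ℕ × ℕ => p q.1 * (p q.2.1 * p q.2.2) :=
    hps.mul_of_nonneg hps2 hp0 fun q => mul_nonneg (hp0 _) (hp0 _)
  have hnn : ∀ q : ℕ × ℕ × ℕ, 0 ≤ p q.1 * (p q.2.1 * p q.2.2) := fun q =>
    mul_nonneg (hp0 _) (mul_nonneg (hp0 _) (hp0 _))
  -- The added 1 only makes the constant strictly positive.
  refine ⟨4 * ∑' q : ℕ × ℕ × ℕ, p q.1 * (p q.2.1 * p q.2.2) + 1, by positivity, fun k Y => ?_⟩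
  set T : (Fin d → ℤ) → ℕ × ℕ × ℕ := fun x =>
    ((x (Fin.castLE hd 0)).toNat, (x (Fin.castLE hd 1)).toNat, (x (Fin.castLE hd 2)).toNat) with hT
  have hinj : Set.InjOn T (Y.filter InOrthant : Finset (Fin d → ℤ)) := by
    intro x hx y hy hxy
    rw [Finset.mem_coe, Finset.mem_filter] at hx hy
    simp only [hT, Prod.mk.injEq] at hxy
    funext j
    by_cases hj : j.val < 3
    · have hx' := hx.2.1 j
      have hy' := hy.2.1 j
      have : ∀ i : Fin 3, (x (Fin.castLE hd i)).toNat = (y (Fin.castLE hd i)).toNat := by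
        intro i
        fin_cases i
        · exact hxy.1
        · exact hxy.2.1
        · exact hxy.2.2
      have := this ⟨j.val, hj⟩
      rw [castLE_eq_of_lt] at this
      omega
    · rw [hx.2.2 j (by omega), hy.2.2 j (by omega)]
  calc ∑ y ∈ Y, urnFlow hd k y ^ 2 = ∑ y ∈ Y.filter InOrthant, urnFlow hd k y ^ 2 := by
        refine (Finset.sum_filter_of_ne fun y _ hy => ?_).symm
        by_contra h
        simp [urnFlow, h] at hy
    _ ≤ ∑ y ∈ Y.filter InOrthant, 4 * (p (T y).1 * (p (T y).2.1 * p (T y).2.2)) := by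
        refine Finset.sum_le_sum fun y hy => ?_
        refine (urnFlow_sq_le hd k (Finset.mem_filter.1 hy).2).trans_eq ?_
        rw [Fin.prod_univ_three, mul_assoc]
    _ = 4 * ∑ q ∈ (Y.filter InOrthant).image T, p q.1 * (p q.2.1 * p q.2.2) := by
        rw [Finset.sum_image hinj, Finset.mul_sum]
    _ ≤ 4 * ∑' q : ℕ × ℕ × ℕ, p q.1 * (p q.2.1 * p q.2.2) := by
        gcongr
        exact hps3.sum_le_tsum _ fun q _ => hnn q
    _ ≤ _ := by linarith

end Flow

/-! ### Lower bounds for the energy -/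

section Energy

variable {d : ℕ} {Λ : Finset (Fin d → ℤ)}

/-- The extension of a configuration in `Λ` by the zero boundary condition. -/
def zeroExt (φ : Λ → ℝ) (x : Fin d → ℤ) : ℝ := if h : x ∈ Λ then φ ⟨x, h⟩ else 0

@[simp]
theorem zeroExt_coe (φ : Λ → ℝ) (i : Λ) : zeroExt φ i = φ i := by simp [zeroExt]

theorem zeroExt_of_notMem (φ : Λ → ℝ) {x : Fin d → ℤ} (hx : x ∉ Λ) : zeroExt φ x = 0 := by
  simp [zeroExt, hx]

theorem measurable_zeroExt (x : Fin d → ℤ) : Measurable fun φ : Λ → ℝ => zeroExt φ x := by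
  unfold zeroExt
  split_ifs
  · exact measurable_pi_apply _
  · exact measurable_const

/-- The Dirichlet form of the extended configuration. -/
def dirichlet (φ : Λ → ℝ) : ℝ :=
  ∑ i ∈ Λ, ∑ j ∈ neighbors i, (zeroExt φ i - zeroExt φ j) ^ 2

theorem card_neighbors_le (i : Fin d → ℤ) : (neighbors i).card ≤ 3 ^ d := by
  refine (Finset.card_filter_le _ _).trans ?_
  rw [Pi.card_Icc]
  simp only [Int.card_Icc, Pi.add_apply, Pi.sub_apply, Pi.one_apply]
  rw [Finset.prod_congr rfl (g := fun _ => 3) fun k _ => by omega]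
  simp

theorem sum_inner_neighbors (i : Fin d → ℤ) (f : (Fin d → ℤ) → ℝ) :
    ∑ j ∈ Finset.univ.filter (fun j : Λ => (j : Fin d → ℤ) ∈ neighbors i), f j
      = ∑ j ∈ neighbors i ∩ Λ, f j := by
  rw [Finset.sum_filter, Finset.sum_coe_sort Λ (fun j => if j ∈ neighbors i then f j else 0),
    ← Finset.sum_filter, Finset.filter_mem_eq_inter, Finset.inter_comm]

theorem energy_eq (V : ℝ → ℝ) (h : (Fin d → ℤ) → ℝ) (φ : Λ → ℝ) :
    energy V Λ h φ = 1 / (4 * (d : ℝ)) * ∑ i ∈ Λ,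
        (1 / 2 * ∑ j ∈ neighbors i ∩ Λ, V (zeroExt φ i - zeroExt φ j)
          + ∑ j ∈ neighbors i \ Λ, V (zeroExt φ i - zeroExt φ j))
      - ∑ i ∈ Λ, h i * zeroExt φ i := by
  have h1 : ∀ i : Λ, ∑ j ∈ Finset.univ.filter
      (fun j : Λ => (j : Fin d → ℤ) ∈ neighbors (i : Fin d → ℤ)), V (φ i - φ j)
      = ∑ j ∈ neighbors (i : Fin d → ℤ) ∩ Λ, V (zeroExt φ i - zeroExt φ j) := fun i => by
    rw [← sum_inner_neighbors (i : Fin d → ℤ) fun j => V (zeroExt φ i - zeroExt φ j)]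
    simp
  have h2 : ∀ i : Λ, ∑ _j ∈ neighbors (i : Fin d → ℤ) \ Λ, V (φ i)
      = ∑ j ∈ neighbors (i : Fin d → ℤ) \ Λ, V (zeroExt φ i - zeroExt φ j) := fun i => by
    refine Finset.sum_congr rfl fun j hj => ?_
    rw [zeroExt_coe, zeroExt_of_notMem φ (Finset.mem_sdiff.1 hj).2, sub_zero]
  have h3 : ∑ i : Λ, h i * φ i = ∑ i ∈ Λ, h i * zeroExt φ i := by
    simp [← Finset.sum_coe_sort Λ]
  rw [energy, h3, Finset.sum_congr rfl fun i _ => h1 i, Finset.sum_congr rfl fun i _ => h2 i,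
    Finset.sum_coe_sort Λ fun i => ∑ j ∈ neighbors i ∩ Λ, V (zeroExt φ i - zeroExt φ j),
    Finset.sum_coe_sort Λ fun i => ∑ j ∈ neighbors i \ Λ, V (zeroExt φ i - zeroExt φ j),
    Finset.sum_add_distrib, ← Finset.mul_sum, mul_add]

/-- Growth `c / 4` gives `c / 8` per ordered inner pair because of the weight 1/2; boundary bonds
are weakened to match. The error `m` is charged once per neighbour, with the crude count `3 ^ d`. -/
theorem energy_lower_bound {V : ℝ → ℝ} {c m : ℝ} (hc : 0 < c) (hm : 0 ≤ m)
    (hV : ∀ t, V 0 + c / 4 * t ^ 2 - m ≤ V t) (h : (Fin d → ℤ) → ℝ) (φ : Λ → ℝ) :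
    energy V Λ h 0 + c / (32 * d) * dirichlet φ - 3 ^ d * m / (4 * d) * Λ.card
      - ∑ i ∈ Λ, h i * zeroExt φ i ≤ energy V Λ h φ := by
  have hz : ∀ x, zeroExt (0 : Λ → ℝ) x = 0 := fun x => by
    unfold zeroExt
    split_ifs <;> rfl
  have hloc : ∀ i : Fin d → ℤ,
      (1 / 2 * ∑ j ∈ neighbors i ∩ Λ, V 0 + ∑ j ∈ neighbors i \ Λ, V 0)
        + (c / 8 * ∑ j ∈ neighbors i, (zeroExt φ i - zeroExt φ j) ^ 2 - 3 ^ d * m) ≤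
      1 / 2 * ∑ j ∈ neighbors i ∩ Λ, V (zeroExt φ i - zeroExt φ j)
          + ∑ j ∈ neighbors i \ Λ, V (zeroExt φ i - zeroExt φ j) := by
    intro i
    have hcard : ∑ j ∈ neighbors i, m ≤ 3 ^ d * m := by
      rw [Finset.sum_const, nsmul_eq_mul]
      gcongr
      exact_mod_cast card_neighbors_le i
    have hin : ∑ j ∈ neighbors i ∩ Λ, (c / 8 * (zeroExt φ i - zeroExt φ j) ^ 2 - m + 1 / 2 * V 0) ≤
        ∑ j ∈ neighbors i ∩ Λ, 1 / 2 * V (zeroExt φ i - zeroExt φ j) :=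
      Finset.sum_le_sum fun j _ => by linarith [hV (zeroExt φ i - zeroExt φ j)]
    have hout : ∑ j ∈ neighbors i \ Λ, (c / 8 * (zeroExt φ i - zeroExt φ j) ^ 2 - m + V 0) ≤
        ∑ j ∈ neighbors i \ Λ, V (zeroExt φ i - zeroExt φ j) :=
      Finset.sum_le_sum fun j _ => by
        have : 0 ≤ c / 8 * (zeroExt φ i - zeroExt φ j) ^ 2 := by positivity
        linarith [hV (zeroExt φ i - zeroExt φ j)]
    have hsplit := Finset.sum_inter_add_sum_sdiff (neighbors i) Λ
      fun j => c / 8 * (zeroExt φ i - zeroExt φ j) ^ 2 - m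
    rw [Finset.sum_add_distrib] at hin hout
    rw [Finset.sum_sub_distrib (s := neighbors i), ← Finset.mul_sum] at hsplit
    rw [← Finset.mul_sum, ← Finset.mul_sum] at hin
    linarith
  rw [energy_eq V h φ, energy_eq V h 0]
  simp only [hz, sub_zero, mul_zero, Finset.sum_const_zero]
  have hsum := Finset.sum_le_sum fun i (_ : i ∈ Λ) => hloc i
  rw [Finset.sum_add_distrib, Finset.sum_sub_distrib, ← Finset.mul_sum, Finset.sum_const,
    nsmul_eq_mul] at hsum
  have hd0 : (0 : ℝ) ≤ 1 / (4 * d) := by positivity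
  have := mul_le_mul_of_nonneg_left hsum hd0
  rw [dirichlet]
  have hr : c / (32 * d) * (∑ i ∈ Λ, ∑ j ∈ neighbors i, (zeroExt φ i - zeroExt φ j) ^ 2)
      - 3 ^ d * m / (4 * d) * Λ.card = 1 / (4 * d) *
        (c / 8 * (∑ i ∈ Λ, ∑ j ∈ neighbors i, (zeroExt φ i - zeroExt φ j) ^ 2)
          - Λ.card * (3 ^ d * m)) := by
    rcases eq_or_ne (d : ℝ) 0 with h0 | h0
    · simp [h0]
    · field_simp
      ring
  linarith

variable (hd : 3 ≤ d)

theorem sum_abs_unitVec (k : Fin 3) : ∑ l, |unitVec hd k l| = 1 := by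
  rw [Finset.sum_eq_single (Fin.castLE hd k)] <;> simp +contextual [unitVec]

theorem add_unitVec_mem_neighbors (k : Fin 3) (x : Fin d → ℤ) :
    x + unitVec hd k ∈ neighbors x := by
  rw [mem_neighbors, ← sum_abs_unitVec hd k]
  simp

theorem sub_unitVec_mem_neighbors (k : Fin 3) (x : Fin d → ℤ) :
    x - unitVec hd k ∈ neighbors x := by
  rw [mem_neighbors, ← sum_abs_unitVec hd k]
  simp

/-- The sites `x` for which the bond `{x, x + e_k}` touches `Λ`. -/
def bondBase (Λ : Finset (Fin d → ℤ)) (k : Fin 3) : Finset (Fin d → ℤ) :=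
  Λ ∪ Λ.image fun x => x - unitVec hd k

theorem sum_add_unitVec_le_dirichlet (k : Fin 3) (φ : Λ → ℝ) :
    ∑ y ∈ Λ, (zeroExt φ y - zeroExt φ (y + unitVec hd k)) ^ 2 ≤ dirichlet φ :=
  Finset.sum_le_sum fun y _ => Finset.single_le_sum
    (f := fun j => (zeroExt φ y - zeroExt φ j) ^ 2) (fun _ _ => sq_nonneg _)
    (add_unitVec_mem_neighbors hd k y)

theorem sum_sub_unitVec_le_dirichlet (k : Fin 3) (φ : Λ → ℝ) :
    ∑ y ∈ Λ, (zeroExt φ y - zeroExt φ (y - unitVec hd k)) ^ 2 ≤ dirichlet φ :=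
  Finset.sum_le_sum fun y _ => Finset.single_le_sum
    (f := fun j => (zeroExt φ y - zeroExt φ j) ^ 2) (fun _ _ => sq_nonneg _)
    (sub_unitVec_mem_neighbors hd k y)

/-- A bond touching `Λ` has its lower or its upper endpoint there; each of the two families is
bounded by one Dirichlet form. -/
theorem sum_bondBase_le_dirichlet (k : Fin 3) (φ : Λ → ℝ) :
    ∑ y ∈ bondBase hd Λ k, (zeroExt φ y - zeroExt φ (y + unitVec hd k)) ^ 2
      ≤ 2 * dirichlet φ := by
  have hunion := Finset.sum_union_inter (s₁ := Λ) (s₂ := Λ.image fun x => x - unitVec hd k)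
    (f := fun y => (zeroExt φ y - zeroExt φ (y + unitVec hd k)) ^ 2)
  have hnn : 0 ≤ ∑ y ∈ Λ ∩ Λ.image fun x => x - unitVec hd k,
      (zeroExt φ y - zeroExt φ (y + unitVec hd k)) ^ 2 := Finset.sum_nonneg fun _ _ => sq_nonneg _
  rw [Finset.sum_image (fun x _ y _ hxy => sub_left_injective hxy)] at hunion
  have h1 := sum_add_unitVec_le_dirichlet hd k φ
  have h2 := sum_sub_unitVec_le_dirichlet hd k φ
  simp only [sub_add_cancel] at hunion
  have h3 : ∑ x ∈ Λ, (zeroExt φ (x - unitVec hd k) - zeroExt φ x) ^ 2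
      = ∑ y ∈ Λ, (zeroExt φ y - zeroExt φ (y - unitVec hd k)) ^ 2 :=
    Finset.sum_congr rfl fun _ _ => by ring
  rw [bondBase]
  linarith

/-- The superposition of the urn flows started from the sites of `Λ` with strengths `h`. -/
def fieldFlow (Λ : Finset (Fin d → ℤ)) (h : (Fin d → ℤ) → ℝ) (k : Fin 3) (y : Fin d → ℤ) : ℝ :=
  ∑ i ∈ Λ, h i * urnFlow hd k (y - i)

/-- The energy of the superposed flow on the bonds touching `Λ`. -/
def flowEnergy (Λ : Finset (Fin d → ℤ)) (h : (Fin d → ℤ) → ℝ) : ℝ :=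
  ∑ k, ∑ y ∈ bondBase hd Λ k, fieldFlow hd Λ h k y ^ 2

/-- Summation by parts. No boundary term appears because the extension vanishes off `Λ`, so the flow
need not stop at the boundary. -/
theorem sum_bondBase_mul_grad (k : Fin 3) (F : (Fin d → ℤ) → ℝ) (φ : Λ → ℝ) :
    ∑ y ∈ bondBase hd Λ k, F y * (zeroExt φ y - zeroExt φ (y + unitVec hd k))
      = ∑ y ∈ Λ, (F y - F (y - unitVec hd k)) * zeroExt φ y := by
  have h1 : ∑ y ∈ bondBase hd Λ k, F y * zeroExt φ y = ∑ y ∈ Λ, F y * zeroExt φ y := by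
    refine (Finset.sum_subset Finset.subset_union_left fun y _ hy => ?_).symm
    rw [zeroExt_of_notMem φ hy, mul_zero]
  have h2 : ∑ y ∈ bondBase hd Λ k, F y * zeroExt φ (y + unitVec hd k)
      = ∑ y ∈ Λ, F (y - unitVec hd k) * zeroExt φ y := by
    rw [bondBase, ← Finset.sum_subset (s₁ := Λ.image fun x => x - unitVec hd k) Finset.subset_union_right,
      Finset.sum_image (fun x _ y _ hxy => sub_left_injective hxy)]
    · simp
    · intro y _ hy
      rw [zeroExt_of_notMem φ fun h => hy (Finset.mem_image.2 ⟨_, h, by simp⟩), mul_zero]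
  simp only [mul_sub, sub_mul, Finset.sum_sub_distrib, h1, h2]

/-- By superposition of unit sources, the flow has divergence `h` at each site of `Λ`. -/
theorem sum_field_eq_flow (h : (Fin d → ℤ) → ℝ) (φ : Λ → ℝ) :
    ∑ i ∈ Λ, h i * zeroExt φ i = ∑ k, ∑ y ∈ bondBase hd Λ k,
      fieldFlow hd Λ h k y * (zeroExt φ y - zeroExt φ (y + unitVec hd k)) := by
  simp only [sum_bondBase_mul_grad]
  rw [Finset.sum_comm]
  refine Finset.sum_congr rfl fun y hy => ?_
  rw [← Finset.sum_mul]
  congr 1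
  have : ∀ k, fieldFlow hd Λ h k y - fieldFlow hd Λ h k (y - unitVec hd k)
      = ∑ i ∈ Λ, h i * (urnFlow hd k (y - i) - urnFlow hd k (y - i - unitVec hd k)) := fun k => by
    simp only [fieldFlow, mul_sub, Finset.sum_sub_distrib, sub_right_comm y (unitVec hd k)]
  simp only [this]
  rw [Finset.sum_comm]
  simp only [← Finset.mul_sum, urnFlow_divergence, sub_eq_zero]
  simp [hy]

/-- Young's inequality on each bond; the 6 is three directions times the factor 2 of
`sum_bondBase_le_dirichlet`. -/
theorem sum_field_le (h : (Fin d → ℤ) → ℝ) (φ : Λ → ℝ) {α : ℝ} (hα : 0 < α) :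
    ∑ i ∈ Λ, h i * zeroExt φ i ≤ 6 * α * dirichlet φ + 1 / (4 * α) * flowEnergy hd Λ h := by
  have hpt : ∀ u v : ℝ, u * v ≤ α * v ^ 2 + 1 / (4 * α) * u ^ 2 := fun u v => by
    have : α * v ^ 2 + 1 / (4 * α) * u ^ 2 - u * v = (2 * α * v - u) ^ 2 / (4 * α) := by
      field_simp
      ring
    have : 0 ≤ (2 * α * v - u) ^ 2 / (4 * α) := by positivity
    linarith
  rw [sum_field_eq_flow hd]
  calc _ ≤ ∑ k, ∑ y ∈ bondBase hd Λ k,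
        (α * (zeroExt φ y - zeroExt φ (y + unitVec hd k)) ^ 2
          + 1 / (4 * α) * fieldFlow hd Λ h k y ^ 2) :=
        Finset.sum_le_sum fun k _ => Finset.sum_le_sum fun y _ => hpt _ _
    _ = α * ∑ k, ∑ y ∈ bondBase hd Λ k, (zeroExt φ y - zeroExt φ (y + unitVec hd k)) ^ 2
          + 1 / (4 * α) * flowEnergy hd Λ h := by
        simp only [Finset.sum_add_distrib, flowEnergy, Finset.mul_sum]
    _ ≤ α * ∑ k : Fin 3, 2 * dirichlet φ + 1 / (4 * α) * flowEnergy hd Λ h := by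
        gcongr with k
        exact sum_bondBase_le_dirichlet hd k φ
    _ = _ := by
        simp
        ring

/-- The energy dominates a sum of squared increments in one lattice direction. -/
theorem energy_lower_bound_increments {V : ℝ → ℝ} {c m : ℝ} (hc : 0 < c) (hm : 0 ≤ m)
    (hV : ∀ t, V 0 + c / 4 * t ^ 2 - m ≤ V t) (h : (Fin d → ℤ) → ℝ) (φ : Λ → ℝ) :
    energy V Λ h 0 + c / (64 * d) * ∑ i : Λ, (φ i - zeroExt φ (i + unitVec hd 0)) ^ 2
      - 3 ^ d * m / (4 * d) * Λ.card - 96 * d / c * flowEnergy hd Λ h ≤ energy V Λ h φ := by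
  have hd0 : (0 : ℝ) < d := by exact_mod_cast (by omega : 0 < d)
  have h1 := energy_lower_bound hc hm hV h φ
  -- This α makes the field cost exactly half of the Dirichlet coefficient `c / (32 * d)`; the other
  -- half controls the increments.
  have h2 := sum_field_le hd h φ (α := c / (384 * d)) (by positivity)
  have h3 : 1 / (4 * (c / (384 * d))) = 96 * d / c := by
    field_simp
    norm_num
  have h4 : 6 * (c / (384 * d)) = c / (64 * d) := by
    field_simp
    norm_num
  have h5 : c / (32 * d) = c / (64 * d) + c / (64 * d) := by
    field_simp
    norm_num
  have h6 := sum_add_unitVec_le_dirichlet hd 0 φ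
  rw [← Finset.sum_coe_sort] at h6
  simp only [zeroExt_coe] at h6
  have h7 := mul_le_mul_of_nonneg_left h6 (by positivity : 0 ≤ c / (64 * d))
  rw [h3, h4] at h2
  rw [h5] at h1
  linarith

end Energy

/-! ### Pinning in a fixed field -/

section Gibbs

variable {d : ℕ} {Λ : Finset (Fin d → ℤ)}

/-- The a priori single-site measure. -/
abbrev siteMeasure (ε : ℝ) : Measure ℝ := volume + ε.toNNReal • Measure.dirac 0

/-- The weight `ε⁻¹` for a pinned site. -/
def pinWeight (ε t : ℝ) : ℝ := if t = 0 then ε⁻¹ else 1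

theorem measurable_pinWeight (ε : ℝ) : Measurable (pinWeight ε) :=
  Measurable.ite (measurableSet_singleton 0) measurable_const measurable_const

theorem pinWeight_nonneg {ε : ℝ} (hε : 0 < ε) (t : ℝ) : 0 ≤ pinWeight ε t := by
  unfold pinWeight
  split_ifs <;> positivity

theorem inv_le_pinWeight {ε : ℝ} (hε : 1 < ε) (t : ℝ) : ε⁻¹ ≤ pinWeight ε t := by
  unfold pinWeight
  split_ifs
  · rfl
  · exact inv_le_one_of_one_le₀ hε.le

theorem pinWeight_le_one {ε : ℝ} (hε : 1 < ε) (t : ℝ) : pinWeight ε t ≤ 1 := by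
  unfold pinWeight
  split_ifs
  · exact inv_le_one_of_one_le₀ hε.le
  · rfl

/-- The Lebesgue part is a Gaussian integral, independent of the centre by translation; at the atom
`ε` cancels `ε⁻¹` and the exponential is at most 1. -/
theorem lintegral_pinWeight_gaussian_le {a ε : ℝ} (ha : 0 < a) (hε : 0 < ε) (x : ℝ) :
    ∫⁻ t, ENNReal.ofReal (pinWeight ε t * Real.exp (-a * (t - x) ^ 2)) ∂(siteMeasure ε)
      ≤ ENNReal.ofReal (√(Real.pi / a) + 1) := by
  rw [lintegral_add_measure, ENNReal.ofReal_add (by positivity) zero_le_one]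
  refine add_le_add ?_ ?_
  · have hae : ∀ᵐ t : ℝ, ENNReal.ofReal (pinWeight ε t * Real.exp (-a * (t - x) ^ 2))
        = ENNReal.ofReal (Real.exp (-a * (t - x) ^ 2)) := by
      filter_upwards [Measure.ae_ne volume (0 : ℝ)] with t ht
      simp [pinWeight, ht]
    rw [lintegral_congr_ae hae,
      lintegral_sub_right_eq_self (fun t => ENNReal.ofReal (Real.exp (-a * t ^ 2))) x,
      ← ofReal_integral_eq_lintegral_ofReal (integrable_exp_neg_mul_sq ha)
        (ae_of_all _ fun _ => (Real.exp_pos _).le), integral_gaussian]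
  · rw [lintegral_smul_measure, lintegral_dirac, ENNReal.smul_def, smul_eq_mul,
      ← ENNReal.ofReal, ← ENNReal.ofReal_mul hε.le]
    refine ENNReal.ofReal_le_ofReal ?_
    rw [pinWeight, if_pos rfl, mul_inv_cancel_left₀ hε.ne']
    refine Real.exp_le_one_iff.2 ?_
    have : 0 ≤ a * (0 - x) ^ 2 := by positivity
    linarith

theorem measurable_energy {V : ℝ → ℝ} (hV : Measurable V) :
    Measurable fun p : ((Fin d → ℤ) → ℝ) × (Λ → ℝ) => energy V Λ p.1 p.2 := by
  unfold energy
  fun_prop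

theorem measurable_energy_right {V : ℝ → ℝ} (hV : Measurable V) (h : (Fin d → ℤ) → ℝ) :
    Measurable fun φ : Λ → ℝ => energy V Λ h φ := by
  unfold energy
  fun_prop

/-- With the pinned sites down-weighted to the reference strength one, the partition function
is bounded uniformly in `ε`. -/
theorem lintegral_pinWeight_gibbsWeight_le (hd : 3 ≤ d) {V : ℝ → ℝ} (hV : Measurable V)
    {a ε R : ℝ} (ha : 0 < a) (hε : 0 < ε) {h : (Fin d → ℤ) → ℝ}
    (hE : ∀ φ : Λ → ℝ, energy V Λ h 0 + a * ∑ i : Λ, (φ i - zeroExt φ (i + unitVec hd 0)) ^ 2 - R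
      ≤ energy V Λ h φ) :
    ∫⁻ φ, ENNReal.ofReal (∏ i, pinWeight ε (φ i)) ∂(gibbsWeight V ε Λ h)
      ≤ ENNReal.ofReal
          (Real.exp (R - energy V Λ h 0) * (√(Real.pi / a) + 1) ^ Λ.card) := by
  classical
  set κ : ℝ → ℝ → ENNReal := fun t x =>
    ENNReal.ofReal (pinWeight ε t * Real.exp (-a * (t - x) ^ 2)) with hκ
  have hκm : Measurable (Function.uncurry κ) := by
    have := measurable_pinWeight ε
    simp only [hκ, Function.uncurry_def]
    fun_prop
  have hmW : Measurable fun φ : Λ → ℝ => ENNReal.ofReal (∏ i, pinWeight ε (φ i)) := by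
    have := measurable_pinWeight ε
    fun_prop
  have hmE : Measurable fun φ : Λ → ℝ => ENNReal.ofReal (Real.exp (-energy V Λ h φ)) := by
    have := measurable_energy_right (Λ := Λ) hV h
    fun_prop
  set w : Λ → (Λ → ℝ) → ℝ := fun i φ => zeroExt φ (i + unitVec hd 0) with hw
  -- Sites are ranked by their first coordinate; the centre for `i` sits at `i + e_0`, one rank
  -- higher.
  have hwr : ∀ i j : Λ, (j : Fin d → ℤ) (Fin.castLE hd 0) ≤ (i : Fin d → ℤ) (Fin.castLE hd 0) →
      ∀ x y, w i (Function.update x j y) = w i x := by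
    intro i j hij x y
    simp only [hw, zeroExt]
    split_ifs with hmem
    · rw [Function.update_of_ne]
      rintro rfl
      simp [unitVec] at hij
    · rfl
  have hiter := lintegral_pi_prod_le (siteMeasure ε)
    (fun i : Λ => (i : Fin d → ℤ) (Fin.castLE hd 0)) w (fun i => measurable_zeroExt _) hwr κ hκm
    _ (lintegral_pinWeight_gaussian_le ha hε)
  rw [Fintype.card_coe] at hiter
  rw [gibbsWeight, lintegral_withDensity_eq_lintegral_mul _ hmE hmW]
  have hle : ∀ φ : Λ → ℝ, ((fun φ => ENNReal.ofReal (Real.exp (-energy V Λ h φ))) *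
      fun φ : Λ → ℝ => ENNReal.ofReal (∏ i, pinWeight ε (φ i))) φ
      ≤ ENNReal.ofReal (Real.exp (R - energy V Λ h 0)) * ∏ i, κ (φ i) (w i φ) := by
    intro φ
    have hp : 0 ≤ ∏ i, pinWeight ε (φ i) := Finset.prod_nonneg fun i _ => pinWeight_nonneg hε _
    rw [Pi.mul_apply, ← ENNReal.ofReal_prod_of_nonneg
      (fun i _ => mul_nonneg (pinWeight_nonneg hε _) (Real.exp_pos _).le),
      ← ENNReal.ofReal_mul (Real.exp_pos _).le, ← ENNReal.ofReal_mul (Real.exp_pos _).le]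
    refine ENNReal.ofReal_le_ofReal ?_
    rw [Finset.prod_mul_distrib, ← Real.exp_sum, ← Finset.mul_sum, mul_comm (∏ i, _), ← mul_assoc,
      ← Real.exp_add]
    gcongr
    have := hE φ
    simp only [hw]
    linarith
  refine (lintegral_mono hle).trans ?_
  rw [lintegral_const_mul, ENNReal.ofReal_mul (Real.exp_pos _).le,
    ENNReal.ofReal_pow (by positivity)]
  · gcongr
    exact hiter
  · exact Finset.measurable_fun_prod _ fun i _ =>
      hκm.comp ((measurable_pi_apply i).prodMk (measurable_zeroExt _))

theorem partitionFunction_ge {V : ℝ → ℝ} {ε : ℝ} (hε : 0 < ε) (h : (Fin d → ℤ) → ℝ) :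
    ENNReal.ofReal (ε ^ Λ.card * Real.exp (-energy V Λ h 0)) ≤ partitionFunction V ε Λ h := by
  have hsing : referenceMeasure ε Λ {0} = ENNReal.ofReal (ε ^ Λ.card) := by
    rw [referenceMeasure, Measure.pi_singleton]
    simp only [Measure.add_apply, Measure.smul_apply, Pi.zero_apply, measure_singleton, zero_add,
      Measure.dirac_apply_of_mem (Set.mem_singleton (0 : ℝ)), Finset.prod_const, Finset.card_univ,
      Fintype.card_coe]
    rw [ENNReal.ofReal_pow hε.le, ENNReal.smul_def, smul_eq_mul, mul_one, ENNReal.ofReal]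
  calc ENNReal.ofReal (ε ^ Λ.card * Real.exp (-energy V Λ h 0))
      = ∫⁻ φ in {0}, ENNReal.ofReal (Real.exp (-energy V Λ h φ)) ∂(referenceMeasure ε Λ) := by
        rw [lintegral_singleton, hsing, ← ENNReal.ofReal_mul (Real.exp_pos _).le, mul_comm]
    _ = gibbsWeight V ε Λ h {0} := by
        rw [gibbsWeight, withDensity_apply _ (measurableSet_singleton _)]
    _ ≤ _ := measure_mono (Set.subset_univ _)

theorem partitionFunction_ne_zero {V : ℝ → ℝ} {ε : ℝ} (hε : 0 < ε) (h : (Fin d → ℤ) → ℝ) :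
    partitionFunction V ε Λ h ≠ 0 := by
  refine ((ENNReal.ofReal_pos.2 ?_).trans_le (partitionFunction_ge hε h)).ne'
  positivity

/-- Each pin weight is at least `ε⁻¹`, so `ε⁻¹ ^ Λ.card` times the partition function is below the
finite down-weighted integral. -/
theorem partitionFunction_ne_top (hd : 3 ≤ d) {V : ℝ → ℝ} (hV : Measurable V)
    {a ε R : ℝ} (ha : 0 < a) (hε : 1 < ε) {h : (Fin d → ℤ) → ℝ}
    (hE : ∀ φ : Λ → ℝ, energy V Λ h 0 + a * ∑ i : Λ, (φ i - zeroExt φ (i + unitVec hd 0)) ^ 2 - R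
      ≤ energy V Λ h φ) :
    partitionFunction V ε Λ h ≠ ⊤ := by
  have hε0 : 0 < ε := by linarith
  have hbound := lintegral_pinWeight_gibbsWeight_le hd hV ha hε0 hE
  have hlow : ENNReal.ofReal (ε⁻¹ ^ Λ.card) * partitionFunction V ε Λ h ≤
      ∫⁻ φ, ENNReal.ofReal (∏ i, pinWeight ε (φ i)) ∂(gibbsWeight V ε Λ h) := by
    rw [partitionFunction, ← lintegral_const]
    refine lintegral_mono fun φ => ENNReal.ofReal_le_ofReal ?_
    calc ε⁻¹ ^ Λ.card = ∏ _i : Λ, ε⁻¹ := by simp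
      _ ≤ _ := Finset.prod_le_prod (fun _ _ => by positivity) fun i _ => inv_le_pinWeight hε _
  intro htop
  rw [htop, ENNReal.mul_top (ENNReal.ofReal_pos.2 (by positivity)).ne'] at hlow
  exact absurd (hlow.trans hbound) (by simp)

theorem isProbabilityMeasure_gibbs {V : ℝ → ℝ} {ε : ℝ} (hε : 0 < ε) {h : (Fin d → ℤ) → ℝ}
    (hZ : partitionFunction V ε Λ h ≠ ⊤) : IsProbabilityMeasure (gibbs V ε Λ h) :=
  ⟨by
    rw [gibbs, Measure.smul_apply, smul_eq_mul]
    exact ENNReal.inv_mul_cancel (partitionFunction_ne_zero hε h) hZ⟩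

/-- Jensen's inequality for the number of pinned sites. -/
theorem exp_neg_sum_pinProb_le {V : ℝ → ℝ} {ε : ℝ} (hε : 1 < ε) {h : (Fin d → ℤ) → ℝ}
    [IsProbabilityMeasure (gibbs V ε Λ h)] :
    Real.exp (-Real.log ε * ∑ i, pinProb V ε Λ h i) ≤
      ∫ φ, ∏ i, pinWeight ε (φ i) ∂(gibbs V ε Λ h) := by
  have hε0 : 0 < ε := by linarith
  have hset : ∀ i : Λ, MeasurableSet {φ : Λ → ℝ | φ i = 0} := fun i =>
    measurable_pi_apply i (measurableSet_singleton 0)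
  set f : (Λ → ℝ) → ℝ := fun φ =>
    -Real.log ε * ∑ i : Λ, Set.indicator {φ : Λ → ℝ | φ i = 0} (fun _ => (1 : ℝ)) φ with hf
  have hint : ∀ i : Λ, Integrable (Set.indicator {φ : Λ → ℝ | φ i = 0} fun _ => (1 : ℝ))
      (gibbs V ε Λ h) := fun i => (integrable_const 1).indicator (hset i)
  have hfint : Integrable f (gibbs V ε Λ h) :=
    (integrable_finsetSum _ fun i _ => hint i).const_mul _
  have hexp : ∀ φ, Real.exp (f φ) = ∏ i, pinWeight ε (φ i) := by
    intro φ
    simp only [hf]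
    rw [Finset.mul_sum, Real.exp_sum]
    refine Finset.prod_congr rfl fun i _ => ?_
    by_cases h0 : φ i = 0
    · simp [pinWeight, h0, Real.exp_neg, Real.exp_log hε0]
    · simp [pinWeight, h0]
  have hfi : ∫ φ, f φ ∂(gibbs V ε Λ h) = -Real.log ε * ∑ i, pinProb V ε Λ h i := by
    rw [hf, integral_const_mul, integral_finsetSum _ fun i _ => hint i]
    congr 1
    refine Finset.sum_congr rfl fun i _ => ?_
    rw [integral_indicator_const _ (hset i), smul_eq_mul, mul_one, pinProb]
  have hbd : Integrable (Real.exp ∘ f) (gibbs V ε Λ h) := by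
    have hm : AEStronglyMeasurable (Real.exp ∘ f) (gibbs V ε Λ h) :=
      Real.continuous_exp.comp_aestronglyMeasurable hfint.aestronglyMeasurable
    refine Integrable.of_bound hm 1 (ae_of_all _ fun φ => ?_)
    rw [Function.comp_apply, hexp, Real.norm_of_nonneg
      (Finset.prod_nonneg fun i _ => pinWeight_nonneg hε0 _)]
    exact Finset.prod_le_one (fun i _ => pinWeight_nonneg hε0 _) fun i _ => pinWeight_le_one hε _
  have := convexOn_exp.map_integral_le Real.continuous_exp.continuousOn isClosed_univ
    (ae_of_all _ fun _ => Set.mem_univ _) hfint hbd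
  simpa only [hfi, hexp] using this

/-- A lower bound for the expected number of pinned sites in a fixed field. -/
theorem le_sum_pinProb (hd : 3 ≤ d) {V : ℝ → ℝ} (hV : Measurable V)
    {a ε R : ℝ} (ha : 0 < a) (hε : 1 < ε) {h : (Fin d → ℤ) → ℝ}
    (hE : ∀ φ : Λ → ℝ, energy V Λ h 0 + a * ∑ i : Λ, (φ i - zeroExt φ (i + unitVec hd 0)) ^ 2 - R
      ≤ energy V Λ h φ) :
    Λ.card - (R + Λ.card * Real.log (√(Real.pi / a) + 1)) / Real.log ε
      ≤ ∑ i, pinProb V ε Λ h i := by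
  have hε0 : 0 < ε := by linarith
  have hZ := partitionFunction_ne_top hd hV ha hε hE
  have := isProbabilityMeasure_gibbs hε0 hZ
  have hlog : 0 < Real.log ε := Real.log_pos hε
  have hJ := exp_neg_sum_pinProb_le (V := V) (Λ := Λ) (h := h) hε
  set B : ℝ := √(Real.pi / a) + 1 with hB
  have hB0 : 0 < B := by positivity
  have hmW : Measurable fun φ : Λ → ℝ => ∏ i, pinWeight ε (φ i) := by
    have := measurable_pinWeight ε
    fun_prop
  -- The energy of the zero configuration, which contains `V 0`, cancels between the two bounds.
  have hupper : ∫ φ, ∏ i, pinWeight ε (φ i) ∂(gibbs V ε Λ h) ≤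
      Real.exp R * B ^ Λ.card / ε ^ Λ.card := by
    rw [integral_eq_lintegral_of_nonneg_ae
      (ae_of_all _ fun φ => Finset.prod_nonneg fun i _ => pinWeight_nonneg hε0 _)
      hmW.aestronglyMeasurable]
    refine ENNReal.toReal_le_of_le_ofReal (by positivity) ?_
    rw [gibbs, lintegral_smul_measure, smul_eq_mul]
    calc _ ≤ (ENNReal.ofReal (ε ^ Λ.card * Real.exp (-energy V Λ h 0)))⁻¹ *
          ENNReal.ofReal (Real.exp (R - energy V Λ h 0) * B ^ Λ.card) := by
          gcongr
          · exact partitionFunction_ge hε0 h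
          · exact lintegral_pinWeight_gibbsWeight_le hd hV ha hε0 hE
      _ = _ := by
          rw [← ENNReal.ofReal_inv_of_pos (by positivity), ← ENNReal.ofReal_mul (by positivity)]
          congr 1
          rw [Real.exp_sub, Real.exp_neg]
          field_simp
  have hfin := Real.log_le_log (Real.exp_pos _) (hJ.trans hupper)
  rw [Real.log_exp, Real.log_div (by positivity) (by positivity),
    Real.log_mul (by positivity) (by positivity), Real.log_exp, Real.log_pow, Real.log_pow] at hfin
  rw [sub_le_iff_le_add, ← sub_le_iff_le_add', le_div_iff₀ hlog]
  linarith

theorem measurable_pinProb {V : ℝ → ℝ} (hV : Measurable V) (ε : ℝ) (i : Λ) :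
    Measurable fun h => pinProb V ε Λ h i := by
  have hm : Measurable fun p : ((Fin d → ℤ) → ℝ) × (Λ → ℝ) =>
      ENNReal.ofReal (Real.exp (-energy V Λ p.1 p.2)) := by
    have := measurable_energy (Λ := Λ) hV
    fun_prop
  have hset : ∀ s : Set (Λ → ℝ), MeasurableSet s → Measurable fun h => gibbsWeight V ε Λ h s := by
    intro s hs
    simp only [gibbsWeight, withDensity_apply _ hs]
    have : SigmaFinite (referenceMeasure ε Λ) := by
      unfold referenceMeasure
      infer_instance
    exact hm.lintegral_prod_right'
  have hi : MeasurableSet {φ : Λ → ℝ | φ i = 0} :=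
    measurable_pi_apply i (measurableSet_singleton 0)
  simp only [pinProb, gibbs, Measure.real, Measure.smul_apply, smul_eq_mul]
  exact ((hset _ MeasurableSet.univ).inv.mul (hset _ hi)).ennreal_toReal

end Gibbs

/-! ### Averaging over the disorder -/

section Disorder

variable {d : ℕ} {Ω : Type*} [MeasurableSpace Ω] {P : Measure Ω}

theorem integral_eq_zero_of_symmetric {X : Ω → ℝ}
    (hsymm : IdentDistrib (fun ω => -X ω) X P P) : ∫ ω, X ω ∂P = 0 := by
  have := hsymm.integral_eq
  rw [integral_neg] at this
  linarith

/-- Off-diagonal terms factorize by independence and vanish by centring. -/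
theorem integral_sq_sum_eq [IsProbabilityMeasure P] {ι : Type*} {η : ι → Ω → ℝ}
    (hind : iIndepFun η P) (hL2 : ∀ i, MemLp (η i) 2 P) (hmean : ∀ i, ∫ ω, η i ω ∂P = 0)
    (s : Finset ι) (f : ι → ℝ) :
    ∫ ω, (∑ i ∈ s, η i ω * f i) ^ 2 ∂P = ∑ i ∈ s, (∫ ω, η i ω ^ 2 ∂P) * f i ^ 2 := by
  classical
  have hint : ∀ i j, Integrable (fun ω => η i ω * η j ω) P := fun i j =>
    (hL2 i).integrable_mul (hL2 j)
  have hexp : ∀ ω, (∑ i ∈ s, η i ω * f i) ^ 2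
      = ∑ i ∈ s, ∑ j ∈ s, (f i * f j) * (η i ω * η j ω) := fun ω => by
    rw [sq, Finset.sum_mul_sum]
    exact Finset.sum_congr rfl fun i _ => Finset.sum_congr rfl fun j _ => by ring
  simp only [hexp]
  rw [integral_finsetSum _ fun i _ => integrable_finsetSum _ fun j _ => (hint i j).const_mul _]
  refine Finset.sum_congr rfl fun i hi => ?_
  rw [integral_finsetSum _ fun j _ => (hint i j).const_mul _, Finset.sum_eq_single i]
  · rw [integral_const_mul]
    simp only [sq]
    ring
  · intro j _ hji
    have := (hind.indepFun hji.symm).integral_mul_eq_mul_integral (hL2 i).aestronglyMeasurable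
      (hL2 j).aestronglyMeasurable
    simp only [Pi.mul_apply] at this
    rw [integral_const_mul, this, hmean i, zero_mul, mul_zero]
  · exact fun h => absurd hi h

theorem integrable_flowEnergy (hd : 3 ≤ d) (Λ : Finset (Fin d → ℤ)) {η : (Fin d → ℤ) → Ω → ℝ}
    (hL2 : ∀ i, MemLp (η i) 2 P) :
    Integrable (fun ω => flowEnergy hd Λ fun j => η j ω) P := by
  unfold flowEnergy fieldFlow
  refine integrable_finsetSum _ fun k _ => integrable_finsetSum _ fun y _ => ?_
  exact (memLp_finsetSum Λ fun i _ => (hL2 i).mul_const _).integrable_sq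

theorem integral_flowEnergy_le (hd : 3 ≤ d) [IsProbabilityMeasure P] {C σ : ℝ}
    (hC : ∀ (k : Fin 3) (Y : Finset (Fin d → ℤ)), ∑ y ∈ Y, urnFlow hd k y ^ 2 ≤ C)
    (Λ : Finset (Fin d → ℤ)) {η : (Fin d → ℤ) → Ω → ℝ} (hind : iIndepFun η P)
    (hL2 : ∀ i, MemLp (η i) 2 P) (hmean : ∀ i, ∫ ω, η i ω ∂P = 0)
    (hvar : ∀ i, ∫ ω, η i ω ^ 2 ∂P = σ) :
    ∫ ω, flowEnergy hd Λ (fun j => η j ω) ∂P ≤ 3 * C * σ * Λ.card := by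
  have hσ : 0 ≤ σ := hvar 0 ▸ integral_nonneg fun _ => sq_nonneg _
  have hint : ∀ k y, Integrable (fun ω => fieldFlow hd Λ (fun j => η j ω) k y ^ 2) P := fun k y =>
    (memLp_finsetSum Λ fun i _ => (hL2 i).mul_const _).integrable_sq
  unfold flowEnergy
  rw [integral_finsetSum _ fun k _ => integrable_finsetSum _ fun y _ => hint k y]
  have hk : ∀ k, ∫ ω, ∑ y ∈ bondBase hd Λ k, fieldFlow hd Λ (fun j => η j ω) k y ^ 2 ∂P
      ≤ C * σ * Λ.card := by
    intro k
    rw [integral_finsetSum _ fun y _ => hint k y]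
    simp only [fieldFlow, integral_sq_sum_eq hind hL2 hmean, hvar]
    rw [Finset.sum_comm]
    simp only [← Finset.mul_sum]
    calc _ ≤ σ * ∑ i ∈ Λ, C := by
          gcongr with i
          -- Translating by `i` reduces the sum to the flow from the origin, whose energy bound does
          -- not depend on the finite set.
          refine le_trans (le_of_eq ?_) (hC k ((bondBase hd Λ k).image fun y => y - i))
          rw [Finset.sum_image fun x _ y _ hxy => sub_left_injective hxy]
      _ = _ := by
          simp
          ring
  refine (Finset.sum_le_sum fun k _ => hk k).trans_eq ?_
  simp
  ring

end Disorder

end PinnedInterface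

end

/-! ### The main theorem -/

theorem theorem3 (d : ℕ) (hd : 3 ≤ d) (c : ℝ) (hc : 0 < c) (b : ℝ) :
    ∃ C₁ C₂ : ℝ, 0 < C₁ ∧ 0 < C₂ ∧
      ∀ V : ℝ → ℝ, Differentiable ℝ V → Differentiable ℝ (deriv V) →
        IsGLB (Set.range (deriv (deriv V))) c → deriv V 0 = b →
      ∀ (Ω : Type*) [MeasurableSpace Ω] (P : Measure Ω) [IsProbabilityMeasure P]
        (η : (Fin d → ℤ) → Ω → ℝ),
        iIndepFun η P →
        (∀ i, IdentDistrib (η i) (η 0) P P) →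
        IdentDistrib (fun ω => -η 0 ω) (η 0) P P →
        MemLp (η 0) 2 P →
      ∀ ε : ℝ, 1 < ε → ∀ Λ : Finset (Fin d → ℤ), Λ.Nonempty →
        (∀ h : (Fin d → ℤ) → ℝ, IsProbabilityMeasure (PinnedInterface.gibbs V ε Λ h)) ∧
        (∀ i : Λ, Integrable
          (fun ω => PinnedInterface.pinProb V ε Λ (fun j => η j ω) i) P) ∧
        1 - (C₁ + C₂ * ∫ ω, η 0 ω ^ 2 ∂P) / Real.log ε ≤
          1 / (Λ.card : ℝ) *
            ∑ i : Λ, ∫ ω, PinnedInterface.pinProb V ε Λ (fun j => η j ω) i ∂P := by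
  obtain ⟨C, hC0, hC⟩ := PinnedInterface.urnFlow_energy_bounded hd
  have hd0 : (0 : ℝ) < d := by exact_mod_cast (by omega : 0 < d)
  set a : ℝ := c / (64 * d) with ha_def
  have ha : 0 < a := by positivity
  set m : ℝ := b ^ 2 / c with hm_def
  have hm : 0 ≤ m := by positivity
  set M : ℝ := 3 ^ d * m / (4 * d) with hM_def
  have hM : 0 ≤ M := by positivity
  set B : ℝ := √(Real.pi / a) + 1 with hB_def
  have hB : 0 ≤ Real.log B := Real.log_nonneg (by simp [hB_def])
  -- `M` is the energy error per site and `log B` the single-site integral; the 1 ensures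
  -- positivity. The second constant is the Young factor times the energy bound for three
  -- directions.
  refine ⟨M + Real.log B + 1, 96 * d / c * (3 * C), by positivity, by positivity, ?_⟩
  intro V hV hV' hV'' hb Ω _ P _ η hind hid hsymm hL2 ε hε Λ hΛ
  have hε0 : 0 < ε := by linarith
  have hVm : Measurable V := hV.continuous.measurable
  have hVq : ∀ t, V 0 + c / 4 * t ^ 2 - m ≤ V t :=
    PinnedInterface.quadratic_lower_bound hc hV hV' (fun t => hV''.1 ⟨t, rfl⟩) hb
  have hE : ∀ (h : (Fin d → ℤ) → ℝ) (φ : Λ → ℝ), PinnedInterface.energy V Λ h 0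
      + a * ∑ i : Λ, (φ i - PinnedInterface.zeroExt φ (i + PinnedInterface.unitVec hd 0)) ^ 2
      - (M * Λ.card + 96 * d / c * PinnedInterface.flowEnergy hd Λ h)
      ≤ PinnedInterface.energy V Λ h φ := fun h φ => by
    have := PinnedInterface.energy_lower_bound_increments hd hc hm hVq h φ
    linarith
  have hprob : ∀ h : (Fin d → ℤ) → ℝ, IsProbabilityMeasure (PinnedInterface.gibbs V ε Λ h) :=
    fun h => PinnedInterface.isProbabilityMeasure_gibbs hε0
      (PinnedInterface.partitionFunction_ne_top hd hVm ha hε (hE h))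
  have hint : ∀ i : Λ, Integrable
      (fun ω => PinnedInterface.pinProb V ε Λ (fun j => η j ω) i) P := fun i => by
    have hη : AEMeasurable (fun ω j => η j ω) P :=
      aemeasurable_pi_lambda _ fun j => (hid j).aemeasurable_fst
    have hmeas : AEMeasurable (fun ω => PinnedInterface.pinProb V ε Λ (fun j => η j ω) i) P :=
      (PinnedInterface.measurable_pinProb hVm ε i).comp_aemeasurable hη
    refine Integrable.of_bound hmeas.aestronglyMeasurable 1 (ae_of_all _ fun ω => ?_)
    have := hprob fun j => η j ω
    rw [PinnedInterface.pinProb, Real.norm_of_nonneg measureReal_nonneg]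
    exact measureReal_le_one
  refine ⟨hprob, hint, ?_⟩
  have hL2' : ∀ i, MemLp (η i) 2 P := fun i => (hid i).memLp_iff.2 hL2
  have hmean : ∀ i, ∫ ω, η i ω ∂P = 0 := fun i =>
    (hid i).integral_eq.trans (PinnedInterface.integral_eq_zero_of_symmetric hsymm)
  have hvar : ∀ i, ∫ ω, η i ω ^ 2 ∂P = ∫ ω, η 0 ω ^ 2 ∂P := fun i => (hid i).sq.integral_eq
  have hflow := PinnedInterface.integral_flowEnergy_le hd hC Λ hind hL2' hmean hvar
  set σ : ℝ := ∫ ω, η 0 ω ^ 2 ∂P with hσ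
  have hlog : 0 < Real.log ε := Real.log_pos hε
  have hcard : (0 : ℝ) < Λ.card := by exact_mod_cast hΛ.card_pos
  have hfint := PinnedInterface.integrable_flowEnergy (P := P) hd Λ hL2'
  have hsum_int := ((integrable_const (μ := P) (M * Λ.card)).fun_add
    (hfint.const_mul (96 * d / c))).fun_add (integrable_const (Λ.card * Real.log B))
  have hmono := integral_mono
    (f := fun ω => (Λ.card : ℝ) - (M * Λ.card + 96 * d / c *
      PinnedInterface.flowEnergy hd Λ (fun j => η j ω) + Λ.card * Real.log B) / Real.log ε)
    ((integrable_const _).sub (hsum_int.div_const _))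
    (integrable_finsetSum Finset.univ fun i _ => hint i)
    (fun ω => PinnedInterface.le_sum_pinProb hd hVm ha hε (hE fun j => η j ω))
  rw [integral_finsetSum _ fun i _ => hint i,
    integral_sub (integrable_const _) (hsum_int.div_const _), integral_div,
    integral_add ((integrable_const _).fun_add (hfint.const_mul _)) (integrable_const _),
    integral_add (integrable_const _) (hfint.const_mul _),
    integral_const_mul (96 * d / c : ℝ)] at hmono
  simp only [integral_const, probReal_univ, one_smul] at hmono
  rw [one_div, ← div_eq_inv_mul, le_div_iff₀ hcard]
  refine le_trans ?_ hmono
  have hflow' := mul_le_mul_of_nonneg_left hflow (by positivity : 0 ≤ 96 * d / c)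
  rw [sub_mul, one_mul, div_mul_eq_mul_div]
  gcongr
  linarith
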